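/- Let $f(x)=\ln(1+|x|)$, applied entrywise to matrices. Let $A\in\mathbb R^{n\times d}$ with $d\ge 1$ be such that $f(A)$ has full column rank, let $b\in\mathbb R^n$ and $\epsilon,\delta\in(0,1)$. Write $Q=(f(A)\;\;b)\in\mathbb R^{n\times(d+1)}$, $p_u=\|Q_u\|_2^2/\|Q\|_F^2$ for the squared-norm sampling probability of row $u$, and $\kappa=\sigma_1(f(A))/\sigma_d(f(A))$ for the condition number. *Algorithm.* The matrix $(A\;\;b)$ is given as a turnstile stream and is read in one pass by $s$ parallel instances of an $H$-Sketch: hash tables that hold, at each of the subsampling rates $2^{-\ell}$, $0\le \ell\le\lceil\log_2 n\rceil$, and for several repetitions, randomly signed sums of the rows in each bucket. From its tables (and an estimate $\widehat M$ of $\|Q\|_F^2$ that is part of the input of the sampling procedure) instance $t$ picks first a magnitude level and then a row index $u_t$, and returns a noisy copy $h_t\in\mathbb R^{d+1}$ of $Q_{u_t}$ and a sampling probability $\hat p_t$. Let $T$ be the matrix with rows $h_t/\sqrt{s\hat p_t}$, $\tilde M$ its first $d$ columns and $\tilde b$ its last column; the output is a minimizer $\tilde x$ of $\|\tilde Mx-\tilde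 b\|_2$. *Standing assumption on the samples (with a parameter $\gamma\epsilon$).* The indices $u_1,\dots,u_s$ are independent with $\Pr\{u_t=u\}\le(1+\gamma\epsilon)p_u$ for all $u$ (for instance $\Pr\{u_t=u\}=p_u$), and almost surely every sample is good: $|\hat p_t-p_{u_t}|\le\gamma\epsilon\,p_{u_t}$ and $\|h_t-Q_{u_t}\|_2\le\gamma\epsilon\|Q_{u_t}\|_2$. **Theorem.** There are absolute constants $\gamma,C>0$ such that the following holds with $s=\left\lceil C\,\frac{d\kappa^2}{\epsilon^2}\log\frac d\delta\right\rceil$. 1. For any noisy row samples $(u_t,h_t,\hat p_t)_{t\le s}$ that satisfy the standing assumption, and in particular for those that the streaming algorithm extracts from its sketch whenever they satisfy it, with probability at least $1-\delta$ a minimizer $\tilde x$ exists and every such $\tilde x$ satisfies $$\|\tilde M\tilde x-\tilde b\|_2\le(1+\epsilon)\min_{x\in\mathbb R^d}\|f(A)x-b\|_2+\Delta,$$ $$\Delta=\epsilon\left(\sqrt{d+\frac{\|b\|_2^2}{\|f(A)\|_2^2}}\;\kappa\|b\|_2+\sqrt{\|f(A)\|_F^2+\|b\|_2^2}\right).$$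 2. The total space of the algorithm, in words (hash tables, hash seeds, working lists, $T$ and $\tilde x$; the production of the estimate $\widehat M$ is not counted), is $\tilde O\!\left(d^2\kappa^2\log\frac1\delta\right)\cdot\mathrm{poly}(\log n,\frac1\epsilon)$. That is, for every choice of the constants in the sizes of the sketch there are $B>0$ and $a\in\mathbb N$ such that, with $X=d^2\kappa^2\max\{1,\log\frac1\delta\}$, the space is at most $B\,X\,\log^a(2+X)\,\bigl(\log(2+n)/\epsilon\bigr)^a$ for all $n,d,A,b,\epsilon,\delta$ as above. -/

import Mathlib

open MeasureTheory ProbabilityTheory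

universe u

namespace RegSketch

noncomputable section

/-! ### Linear algebra -/

/-- The transformation `f(x) = ln(1 + |x|)`. -/
def logAbs (x : ℝ) : ℝ := Real.log (1 + |x|)

/-- The entrywise transformed matrix `f(A)`. -/
def logMatrix {n d : ℕ} (A : Matrix (Fin n) (Fin d) ℝ) : Matrix (Fin n) (Fin d) ℝ :=
  A.map logAbs

/-- The Euclidean norm of a vector. -/
def l2norm {ι : Type*} [Fintype ι] (v : ι → ℝ) : ℝ := ‖WithLp.toLp 2 v‖

/-- The Frobenius norm `‖M‖_F`. -/
def frobNorm {n d : ℕ} (M : Matrix (Fin n) (Fin d) ℝ) : ℝ :=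
  Real.sqrt (∑ i, ∑ j, M i j ^ 2)

/-- The operator norm `‖M‖₂` with respect to the Euclidean norms. -/
def specNorm {n d : ℕ} (M : Matrix (Fin n) (Fin d) ℝ) : ℝ :=
  ‖(Matrix.toEuclideanLin M).toContinuousLinearMap‖

/-- The condition number `σ₁ / σ_d` of a matrix with `d` columns
(Mathlib numbers the singular values from `0`). -/
def condNumber {n d : ℕ} (M : Matrix (Fin n) (Fin d) ℝ) : ℝ :=
  (Matrix.toEuclideanLin M).singularValues 0 / (Matrix.toEuclideanLin M).singularValues (d - 1)

/-- The concatenated matrix `(M  b)`; the last column is `b`. -/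
def augment {n d : ℕ} (M : Matrix (Fin n) (Fin d) ℝ) (b : Fin n → ℝ) :
    Matrix (Fin n) (Fin (d + 1)) ℝ :=
  Matrix.of fun i => Fin.snoc (α := fun _ => ℝ) (M i) (b i)

/-- The map `g` on `ℝ^(d+1)`: apply `f` to the first `d` coordinates, keep the last one. -/
def transformRow {d : ℕ} (x : Fin (d + 1) → ℝ) : Fin (d + 1) → ℝ :=
  Fin.snoc (α := fun _ => ℝ) (fun k : Fin d => logAbs (x k.castSucc)) (x (Fin.last d))

/-! ### Noisy row samples and the regression step -/

/-- What one sampling instance returns: the position of the sampled row, a noisy copy of the row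
of `(f(A)  b)` at that position, and the returned sampling probability. -/
structure RowSample (n d : ℕ) where
  index : Fin n
  row : Fin (d + 1) → ℝ
  prob : ℝ

/-- The squared-norm sampling probability `p_u = ‖Q_u‖² / ‖Q‖_F²` of row `u`. -/
def rowProb {n m : ℕ} (Q : Matrix (Fin n) (Fin m) ℝ) (u : Fin n) : ℝ :=
  l2norm (Q u) ^ 2 / frobNorm Q ^ 2

/-- A sample is `γ`-good for `Q`: the returned probability is a `(1 ± γ)`-approximation of the
true one, and the noise is at most a `γ`-fraction of the row in Euclidean norm. -/
def IsGoodSample {n d : ℕ} (γ : ℝ) (Q : Matrix (Fin n) (Fin (d + 1)) ℝ) (h : RowSample n d) :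
    Prop :=
  |h.prob - rowProb Q h.index| ≤ γ * rowProb Q h.index ∧
    l2norm (fun k => h.row k - Q h.index k) ≤ γ * l2norm (Q h.index)

/-- The standing assumption on the `s` samples: the sampled positions are independent, they follow
the squared-norm distribution of `Q` up to a factor `1 + γ` (only the upper estimate is required,
so that rows of tiny norm may be missed; sampling with probability exactly `p_u`, or `(1 ± γ) p_u`,
is a special case), and every sample is `γ`-good.  Nothing is assumed on how the noise and the
returned probabilities depend on the positions. -/
structure GoodSampling {n d s : ℕ} {Ω : Type u} [MeasurableSpace Ω] (μ : Measure Ω) (γ : ℝ)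
    (Q : Matrix (Fin n) (Fin (d + 1)) ℝ) (h : Fin s → Ω → RowSample n d) : Prop where
  measurable_index : ∀ t, Measurable fun ω => (h t ω).index
  indep : iIndepFun (fun t ω => (h t ω).index) μ
  law : ∀ t v, μ {ω | (h t ω).index = v} ≤ ENNReal.ofReal ((1 + γ) * rowProb Q v)
  good : ∀ᵐ ω ∂μ, ∀ t, IsGoodSample γ Q (h t ω)

/-- The matrix `T` with rows `h_t / √(s p̂_t)`. -/
def sampleMatrix {n d s : ℕ} (h : Fin s → RowSample n d) : Matrix (Fin s) (Fin (d + 1)) ℝ :=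
  Matrix.of fun t k => (h t).row k / Real.sqrt (s * (h t).prob)

/-- `M̃`: the first `d` columns of `T`. -/
def sketchMatrix {n d s : ℕ} (h : Fin s → RowSample n d) : Matrix (Fin s) (Fin d) ℝ :=
  Matrix.of fun t k => sampleMatrix h t k.castSucc

/-- `b̃`: the last column of `T`. -/
def sketchVector {n d s : ℕ} (h : Fin s → RowSample n d) : Fin s → ℝ :=
  fun t => sampleMatrix h t (Fin.last d)

/-- The regression cost `‖M x - b‖₂`. -/
def cost {n d : ℕ} (M : Matrix (Fin n) (Fin d) ℝ) (b : Fin n → ℝ) (x : Fin d → ℝ) : ℝ :=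
  l2norm (M.mulVec x - b)

/-- `x̃` is an output of the algorithm on the given samples: it minimizes `‖M̃ x - b̃‖₂`. -/
def IsOutput {n d s : ℕ} (h : Fin s → RowSample n d) (x : Fin d → ℝ) : Prop :=
  IsMinOn (cost (sketchMatrix h) (sketchVector h)) Set.univ x

/-- The additive error `Δ`. -/
def additiveError {n d : ℕ} (A : Matrix (Fin n) (Fin d) ℝ) (b : Fin n → ℝ) (ε : ℝ) : ℝ :=
  ε * (Real.sqrt (d + l2norm b ^ 2 / specNorm (logMatrix A) ^ 2) * condNumber (logMatrix A)
        * l2norm b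
      + Real.sqrt (frobNorm (logMatrix A) ^ 2 + l2norm b ^ 2))

/-- An output exists, and every output `x̃` satisfies
`‖M̃ x̃ - b̃‖₂ ≤ (1 + ε) min_x ‖f(A) x - b‖₂ + Δ`. -/
def RegressionGuarantee {n d s : ℕ} (A : Matrix (Fin n) (Fin d) ℝ) (b : Fin n → ℝ) (ε : ℝ)
    (h : Fin s → RowSample n d) : Prop :=
  (∃ x, IsOutput h x) ∧
    ∀ x, IsOutput h x →
      cost (sketchMatrix h) (sketchVector h) x ≤
        (1 + ε) * (⨅ y, cost (logMatrix A) b y) + additiveError A b ε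

/-! ### The streaming sketch

All logarithms that fix sizes are to base `2`. -/

/-- The absolute constants behind the `O(1)`, `O(·)` and `Θ(·)` in the sizes of the sketch:
`nu`, `phi` for the two parameters of a heavy hitter structure, `width` for the number of buckets,
`rep` for the number of repetitions, `top` for the number of heavy hitters that are kept,
`K` for the accuracy of the estimate `M̂` of `‖(f(A)  b)‖_F²`, and `acc` for the rescaling of
the accuracy: the sketch runs with accuracy `acc * ε`. -/
structure SketchConst where
  nu : ℝ
  phi : ℝ
  width : ℝ
  rep : ℝ
  top : ℝ
  K : ℝ
  acc : ℝ
  nu_pos : 0 < nu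
  phi_pos : 0 < phi
  width_pos : 0 < width
  rep_pos : 0 < rep
  top_pos : 0 < top
  one_le_K : 1 ≤ K
  acc_pos : 0 < acc
  acc_le_one : acc ≤ 1

/-- The sizes of one sampling instance: its accuracy `η`, the number `L` of magnitude levels, the
last level `j₀` that is handled without subsampling, the number `L̂` of subsampling rates, the
exponents of the numbers of buckets (a power of two) of `𝓓₀` and of `𝓓₁, …, 𝓓_L̂`, the
number of repetitions in a heavy hitter structure, and the number of heavy hitters kept. -/
structure SketchSize where
  eta : ℝ
  levels : ℕ
  directLevels : ℕ
  rates : ℕ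
  logWidthZero : ℕ
  logWidthSub : ℕ
  reps : ℕ
  reps_pos : 0 < reps
  top : ℕ

/-- `⌈log₂ (width / (φ² ν³))⌉`: a heavy hitter structure with parameters `ν`, `φ` uses
`O(1 / (φ² ν³))` buckets. -/
def logBuckets (c : SketchConst) (φ : ℝ) : ℕ :=
  Nat.clog 2 ⌈c.width / (φ ^ 2 * c.nu ^ 3)⌉₊

/-- The sizes of each of `s` parallel instances on `n` rows with target accuracy `ε`.  Here
`η = acc * ε`, `L = log(K n / η)`, `L̂ = log n`, `j₀ = log(4 K L³ / η³)`; the heavy hitter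
structure `𝓓₀` has `φ = O(η³ / (K L³))`, the structures `𝓓_ℓ`, `ℓ ≥ 1`, have
`φ = O(η³ / L³)`; all have `O(log(n / δ'))` repetitions with failure probability
`δ' = 1 / ((L̂ + 1) s)`, the factor `s` being what lets all `s` samples be good at once; and
`Θ(L³ / η³)` heavy hitters are kept at each rate. -/
def SketchConst.size (c : SketchConst) (n s : ℕ) (ε : ℝ) : SketchSize where
  eta := c.acc * ε
  levels := ⌈Real.logb 2 (c.K * n / (c.acc * ε))⌉₊
  directLevels :=
    ⌈Real.logb 2 (4 * c.K * (⌈Real.logb 2 (c.K * n / (c.acc * ε))⌉₊ : ℝ) ^ 3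
      / (c.acc * ε) ^ 3)⌉₊
  rates := Nat.clog 2 n
  logWidthZero := logBuckets c
    (c.phi * (c.acc * ε) ^ 3
      / (c.K * (⌈Real.logb 2 (c.K * n / (c.acc * ε))⌉₊ : ℝ) ^ 3))
  logWidthSub := logBuckets c
    (c.phi * (c.acc * ε) ^ 3 / (⌈Real.logb 2 (c.K * n / (c.acc * ε))⌉₊ : ℝ) ^ 3)
  reps := ⌈c.rep * Real.logb 2 (n * ((Nat.clog 2 n + 1) * s))⌉₊ + 1
  reps_pos := Nat.succ_pos _
  top := ⌈c.top * (⌈Real.logb 2 (c.K * n / (c.acc * ε))⌉₊ : ℝ) ^ 3 / (c.acc * ε) ^ 3⌉₊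

namespace SketchSize

/-- The exponent of the number of buckets at subsampling rate `2^(-ℓ)`. -/
def logWidth (P : SketchSize) (ℓ : ℕ) : ℕ := if ℓ = 0 then P.logWidthZero else P.logWidthSub

/-- The number of buckets at subsampling rate `2^(-ℓ)`. -/
def width (P : SketchSize) (ℓ : ℕ) : ℕ := 2 ^ P.logWidth ℓ

/-- The number of bits of a word of a hash seed; large enough that `n`, all numbers of buckets
and all subsampling denominators are at most `2 ^ wordBits`. -/
def wordBits (P : SketchSize) : ℕ := P.rates + P.logWidthZero + P.logWidthSub + 1

/-- The field with `2 ^ wordBits` elements, over which the hash functions are polynomials. -/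
abbrev Word (P : SketchSize) : Type := GaloisField 2 P.wordBits

/-- Some numbering of the field by `0, …, 2 ^ wordBits - 1`. -/
def decode (P : SketchSize) : P.Word ≃ Fin (2 ^ P.wordBits) :=
  Finite.equivFinOfCardEq (GaloisField.card 2 P.wordBits (Nat.succ_ne_zero _))

/-- The field element that stands for row `i`. -/
def point (P : SketchSize) {n : ℕ} (i : Fin n) : P.Word :=
  P.decode.symm (Fin.ofNat (2 ^ P.wordBits) i)

/-- The hash value of row `i` under the polynomial with `k` coefficients `a`.  For uniformly random
`a` these values are `k`-wise independent and uniform on `0, …, 2 ^ wordBits - 1`, and so are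
their residues modulo a smaller power of two. -/
def hashValue (P : SketchSize) {k n : ℕ} (a : Fin k → P.Word) (i : Fin n) : ℕ :=
  P.decode (∑ e : Fin k, a e * P.point i ^ (e : ℕ))

end SketchSize

/-- The raw randomness of one sampling instance: seeds of the pairwise independent hash functions
and of the `4`-wise independent signs of every basic heavy hitter structure, seeds of the
pairwise independent subsampling at every rate (drawn uniformly by the algorithm), the
uniform number `ζ ∈ [1/2, 1]`, and two uniform numbers in `[0, 1)` that drive the choice of the
magnitude level and of the row. -/
structure Randomness (P : SketchSize) where
  hashSeed : Fin (P.rates + 1) → Fin P.reps → Fin 2 → P.Word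
  signSeed : Fin (P.rates + 1) → Fin P.reps → Fin 4 → P.Word
  rateSeed : Fin (P.rates + 1) → Fin 2 → P.Word
  zeta : Set.Icc (1 / 2 : ℝ) 1
  levelDraw : Set.Ico (0 : ℝ) 1
  rowDraw : Set.Ico (0 : ℝ) 1

namespace Randomness

variable {P : SketchSize} {n : ℕ}

/-- The bucket of row `i` in repetition `r` of the heavy hitter structure at rate `2^(-ℓ)`. -/
def bucket (ρ : Randomness P) (ℓ : Fin (P.rates + 1)) (r : Fin P.reps) (i : Fin n) :
    Fin (P.width ℓ) :=
  ⟨P.hashValue (ρ.hashSeed ℓ r) i % P.width ℓ, Nat.mod_lt _ (Nat.two_pow_pos _)⟩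

/-- The random sign of row `i` in repetition `r` of the heavy hitter structure at rate `2^(-ℓ)`. -/
def sign (ρ : Randomness P) (ℓ : Fin (P.rates + 1)) (r : Fin P.reps) (i : Fin n) : ℝ :=
  if P.hashValue (ρ.signSeed ℓ r) i % 2 = 0 then 1 else -1

/-- Row `i` survives the subsampling at rate `2^(-ℓ)`. -/
def Kept (ρ : Randomness P) (ℓ : Fin (P.rates + 1)) (i : Fin n) : Prop :=
  P.hashValue (ρ.rateSeed ℓ) i % 2 ^ (ℓ : ℕ) = 0

end Randomness

/-- A turnstile update `X_{row, col} ← X_{row, col} + amount` of the streamed matrix. -/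
structure Update (n m : ℕ) where
  row : Fin n
  col : Fin m
  amount : ℝ

/-- The matrix that a stream of updates builds up from the zero matrix. -/
def streamMatrix {n m : ℕ} (S : List (Update n m)) : Matrix (Fin n) (Fin m) ℝ :=
  Matrix.of fun i k => (S.map fun e => if e.row = i ∧ e.col = k then e.amount else 0).sum

/-- The positions of the hash tables of one instance: at each rate and in each repetition,
every bucket holds a vector of `d + 1` numbers. -/
abbrev TableCell (P : SketchSize) (d : ℕ) : Type :=
  Σ ℓ : Fin (P.rates + 1), Fin P.reps × Fin (P.width ℓ) × Fin (d + 1)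

/-- The content of the hash tables of one instance. -/
abbrev Tables (P : SketchSize) (d : ℕ) : Type := TableCell P d → ℝ

open Classical in
/-- Processing one update of the stream. -/
def processUpdate {P : SketchSize} {n d : ℕ} (ρ : Randomness P) (H : Tables P d)
    (e : Update n (d + 1)) : Tables P d :=
  fun c => H c +
    if ρ.Kept c.1 e.row ∧ ρ.bucket c.1 c.2.1 e.row = c.2.2.1 ∧ e.col = c.2.2.2
    then ρ.sign c.1 c.2.1 e.row * e.amount else 0

/-- The hash tables after one pass over the stream. -/
def sketchStream {P : SketchSize} {n d : ℕ} (ρ : Randomness P) (S : List (Update n (d + 1))) :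
    Tables P d :=
  S.foldl (processUpdate ρ) 0

/-! ### Sampling from the sketch -/

/-- The position of the median of a nonempty list of numbers. -/
def medianIndex {R : ℕ} (hR : 0 < R) (x : Fin R → ℝ) : Fin R :=
  Tuple.sort x ⟨R / 2, Nat.div_lt_self hR one_lt_two⟩

open Classical in
/-- A choice from `Fin m` with probabilities proportional to the nonnegative weights `w`, driven
by a uniform `τ ∈ [0, 1)`; there is none if all weights vanish. -/
def weightedPick {m : ℕ} (w : Fin m → ℝ) (τ : ℝ) : Option (Fin m) :=
  if hne : (Finset.univ.filter fun k => τ * ∑ i, w i < ∑ i ∈ Finset.Iic k, w i).Nonempty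
  then some (Finset.min' _ hne) else none

namespace Randomness

variable {P : SketchSize} {d : ℕ} (n : ℕ) (ρ : Randomness P) (H : Tables P d)

/-- The vector found for row `i` in repetition `r`, with the random sign of the row undone. -/
def bucketVector {n : ℕ} (ℓ : Fin (P.rates + 1)) (i : Fin n) (r : Fin P.reps) :
    Fin (d + 1) → ℝ :=
  fun k => ρ.sign ℓ r i * H ⟨ℓ, r, ρ.bucket ℓ r i, k⟩

/-- The query of row `i` at rate `2^(-ℓ)`: the vector of median transformed norm. -/
def query {n : ℕ} (ℓ : Fin (P.rates + 1)) (i : Fin n) : Fin (d + 1) → ℝ :=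
  ρ.bucketVector H ℓ i
    (medianIndex P.reps_pos fun r => l2norm (transformRow (ρ.bucketVector H ℓ i r)))

/-- The estimate `λ` of the squared transformed norm of row `i` at rate `2^(-ℓ)`. -/
def weight {n : ℕ} (ℓ : Fin (P.rates + 1)) (i : Fin n) : ℝ :=
  l2norm (transformRow (ρ.query H ℓ i)) ^ 2

open Classical in
/-- `Λ_ℓ`: the surviving rows of largest estimate at rate `2^(-ℓ)`, ties broken by position. -/
def heavy (ℓ : Fin (P.rates + 1)) : Finset (Fin n) :=
  Finset.univ.filter fun i => ρ.Kept ℓ i ∧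
    (Finset.univ.filter fun i' : Fin n => ρ.Kept ℓ i' ∧
      (ρ.weight H ℓ i < ρ.weight H ℓ i' ∨
        (ρ.weight H ℓ i' = ρ.weight H ℓ i ∧ i' < i))).card < P.top

open Classical in
/-- The rows of `Λ_ℓ` with estimate in the (slightly shrunk) magnitude level `j`, that is in
`[(1 + η) ζ M̂ / 2^j, (2 - η) ζ M̂ / 2^j]`. -/
def inLevel (Mhat : ℝ) (ℓ : Fin (P.rates + 1)) (j : ℕ) : Finset (Fin n) :=
  (ρ.heavy n H ℓ).filter fun i =>
    (1 + P.eta) * (ρ.zeta * Mhat / 2 ^ j) ≤ ρ.weight H ℓ i ∧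
      ρ.weight H ℓ i ≤ (2 - P.eta) * (ρ.zeta * Mhat / 2 ^ j)

open Classical in
/-- The subsampling rate used for level `j`: none (`ℓ = 0`) for `j ≤ j₀`, and otherwise the
largest `ℓ` at which the number of rows in the level is between `(1 - √20 η) L² / η²` and
`2 (1 + √20 η) L² / η²`, if there is one. -/
def levelRate (Mhat : ℝ) (j : ℕ) : Option (Fin (P.rates + 1)) :=
  if j ≤ P.directLevels then some 0
  else if hne : (Finset.univ.filter fun ℓ : Fin (P.rates + 1) =>
      (1 - Real.sqrt 20 * P.eta) * P.levels ^ 2 / P.eta ^ 2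
          ≤ ((ρ.inLevel n H Mhat ℓ j).card : ℝ) ∧
        ((ρ.inLevel n H Mhat ℓ j).card : ℝ)
          ≤ 2 * (1 + Real.sqrt 20 * P.eta) * P.levels ^ 2 / P.eta ^ 2).Nonempty
  then some (Finset.max' _ hne) else none

/-- `M̃_j`: the estimated total weight of level `j`. -/
def levelMass (Mhat : ℝ) (j : ℕ) : ℝ :=
  match ρ.levelRate n H Mhat j with
  | none => 0
  | some ℓ => 2 ^ (ℓ : ℕ) * ∑ i ∈ ρ.inLevel n H Mhat ℓ j, ρ.weight H ℓ i

open Classical in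
/-- One sample from the sketch: choose a level `j*` in `1, …, L` with probability proportional to
`M̃_j`, then a row `i*` of that level with probability proportional to its estimate `λ`, and
return `i*`, the transformed query `g(v)` of `i*`, and the probability `λ / ∑_j M̃_j`.
There is no sample if nothing has been recovered. -/
def sample (Mhat : ℝ) : Option (RowSample n d) :=
  (weightedPick (fun j : Fin P.levels => ρ.levelMass n H Mhat (j + 1)) ρ.levelDraw).bind
    fun j => (ρ.levelRate n H Mhat (j + 1)).bind
      fun ℓ => (weightedPick
          (fun i : Fin n => if i ∈ ρ.inLevel n H Mhat ℓ (j + 1) then ρ.weight H ℓ i else 0)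
          ρ.rowDraw).map
        fun i =>
          { index := i
            row := transformRow (ρ.query H ℓ i)
            prob := ρ.weight H ℓ i / ∑ j' : Fin P.levels, ρ.levelMass n H Mhat (j' + 1) }

end Randomness

/-! ### Space -/

/-- The number of bits of all hash seeds of one instance. -/
def seedBits (P : SketchSize) : ℕ :=
  ((P.rates + 1) * P.reps * (2 + 4) + (P.rates + 1) * 2) * P.wordBits

/-- The space of one instance, in words: the hash tables; the seeds (counted in bits); position
and estimate of the heavy hitters at each rate; rate and estimated weight of each magnitude level;
the numbers `ζ`, `M̂` and the two draws; and the sample that is returned. -/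
def instanceSpace (P : SketchSize) (d : ℕ) : ℕ :=
  Fintype.card (TableCell P d) + seedBits P + (P.rates + 1) * P.top * 2 + P.levels * 2 + 4
    + (d + 3)

/-- The space of the regression algorithm, in words: `s` parallel instances, the matrix
`T = (M̃  b̃)`, and the output `x̃`. -/
def totalSpace (P : SketchSize) (d s : ℕ) : ℕ :=
  s * instanceSpace P d + s * (d + 1) + d

end

end RegSketch

open RegSketch

/-! The guarantee bounds only the sketched cost of `x̃`, and that is at most the sketched cost of
any fixed vector. So one vector has to be controlled, a least squares solution `x` of the original
problem; no subspace embedding is involved.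

Put `y = (x, -1)` and `R = ‖Q‖_F ‖y‖`. Under squared-norm sampling the row norms cancel against the
probabilities, and the sketched cost depends on the squared cosines between the sampled rows and
`y`. These lie in `[0, 1]` and have mean `(‖f(A) x - b‖ / R)²`, up to the factor `1 + ε/4` allowed
in the law. A Chernoff bound for square roots (`measure_sum_ge_le`) moves the root mean square by at
most `ε/4`, except with probability `exp (-s ε² / 16)`; the noise in rows and probabilities is
absorbed deterministically (`cost_sketch_le`). The result is `(1 + ε) min + ε R`.

Finally `ε R ≤ Δ` (`frobNorm_mul_extend_le`): the image of `x` is a projection of `b`, so `‖x‖ ≤ ‖b‖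
/ σ_d`, while `‖Q‖_F² ≤ d ‖f(A)‖² + ‖b‖²` and `‖f(A)‖ ≤ σ₁`; the quotient of the singular values is
`κ`.

For the space, `s (d + 1)` carries the main term `d² κ² log (1/δ)`. All other sizes are polynomial
in `log (2 + X) log (2 + n) / ε`, which is shown by closure properties of `PolyBounded`. -/

namespace RegSketch

/-! ### Extreme singular values as bounds for `‖T x‖ / ‖x‖` -/

section SingularValues

variable {E F : Type*} [NormedAddCommGroup E] [InnerProductSpace ℝ E] [FiniteDimensional ℝ E]
  [NormedAddCommGroup F] [InnerProductSpace ℝ F] [FiniteDimensional ℝ F]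

/-- The quadratic form of `T* T` in an orthonormal eigenbasis. -/
theorem norm_apply_sq_eq_sum_singularValues (T : E →ₗ[ℝ] F) {m : ℕ}
    (hm : Module.finrank ℝ E = m) (x : E) :
    ‖T x‖ ^ 2 = ∑ i : Fin m, T.singularValues i ^ 2 *
      (T.isSymmetric_adjoint_comp_self.eigenvectorBasis hm).repr x i ^ 2 := by
  have h := (T.isSymmetric_adjoint_comp_self.eigenvectorBasis hm).repr.inner_map_map
    ((LinearMap.adjoint T ∘ₗ T) x) x
  rw [LinearMap.comp_apply, LinearMap.adjoint_inner_left, real_inner_self_eq_norm_sq] at h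
  rw [← h, PiLp.inner_apply]
  refine Finset.sum_congr rfl fun i _ => ?_
  have h2 := T.isSymmetric_adjoint_comp_self.eigenvectorBasis_apply_self_apply hm x i
  rw [LinearMap.comp_apply] at h2
  rw [h2, T.sq_singularValues_fin hm]
  simp
  ring

theorem norm_sq_eq_sum_repr (T : E →ₗ[ℝ] F) {m : ℕ} (hm : Module.finrank ℝ E = m) (x : E) :
    ‖x‖ ^ 2 = ∑ i : Fin m,
      (T.isSymmetric_adjoint_comp_self.eigenvectorBasis hm).repr x i ^ 2 := by
  rw [← (T.isSymmetric_adjoint_comp_self.eigenvectorBasis hm).repr.norm_map x,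
    EuclideanSpace.norm_sq_eq]
  simp

theorem norm_apply_le_singularValues_zero (T : E →ₗ[ℝ] F) (x : E) :
    ‖T x‖ ≤ T.singularValues 0 * ‖x‖ := by
  refine le_of_sq_le_sq ?_ (mul_nonneg (T.singularValues_nonneg 0) (norm_nonneg _))
  rw [mul_pow, norm_apply_sq_eq_sum_singularValues T rfl, norm_sq_eq_sum_repr T rfl x,
    Finset.mul_sum]
  refine Finset.sum_le_sum fun i _ => mul_le_mul_of_nonneg_right ?_ (sq_nonneg _)
  exact pow_le_pow_left₀ (T.singularValues_nonneg _)
    (T.singularValues_antitone (Nat.zero_le _)) 2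

theorem singularValues_last_mul_norm_le (T : E →ₗ[ℝ] F) {m : ℕ}
    (hm : Module.finrank ℝ E = m) (x : E) :
    T.singularValues (m - 1) * ‖x‖ ≤ ‖T x‖ := by
  refine le_of_sq_le_sq ?_ (norm_nonneg _)
  rw [mul_pow, norm_apply_sq_eq_sum_singularValues T hm, norm_sq_eq_sum_repr T hm x,
    Finset.mul_sum]
  refine Finset.sum_le_sum fun i _ => mul_le_mul_of_nonneg_right ?_ (sq_nonneg _)
  exact pow_le_pow_left₀ (T.singularValues_nonneg _)
    -- An index `i : Fin m` satisfies `i ≤ m - 1`; for `m = 0` the sum is empty.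
    (T.singularValues_antitone (by omega)) 2

end SingularValues

/-! ### Least squares solutions and the additive error -/

section LeastSquares

theorem l2norm_nonneg {ι : Type*} [Fintype ι] (v : ι → ℝ) : 0 ≤ l2norm v := norm_nonneg _

theorem l2norm_sq {ι : Type*} [Fintype ι] (v : ι → ℝ) : l2norm v ^ 2 = ∑ i, v i ^ 2 := by
  rw [l2norm, EuclideanSpace.norm_sq_eq]
  simp

theorem abs_dotProduct_le {ι : Type*} [Fintype ι] (v w : ι → ℝ) :
    |v ⬝ᵥ w| ≤ l2norm v * l2norm w := by
  refine abs_le_of_sq_le_sq ?_ (mul_nonneg (l2norm_nonneg _) (l2norm_nonneg _))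
  rw [mul_pow, l2norm_sq, l2norm_sq]
  exact Finset.sum_mul_sq_le_sq_mul_sq _ _ _

variable {n d : ℕ}

theorem frobNorm_nonneg (M : Matrix (Fin n) (Fin d) ℝ) : 0 ≤ frobNorm M := Real.sqrt_nonneg _

theorem frobNorm_sq (M : Matrix (Fin n) (Fin d) ℝ) : frobNorm M ^ 2 = ∑ i, ∑ j, M i j ^ 2 :=
  Real.sq_sqrt (Finset.sum_nonneg fun _ _ => Finset.sum_nonneg fun _ _ => sq_nonneg _)

theorem cost_eq_norm (M : Matrix (Fin n) (Fin d) ℝ) (b : Fin n → ℝ) (x : Fin d → ℝ) :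
    cost M b x = ‖Matrix.toEuclideanLin M (WithLp.toLp 2 x) - WithLp.toLp 2 b‖ := rfl

/-- A least squares problem has a solution whose image has norm at most `‖b‖`. -/
theorem exists_leastSquares (M : Matrix (Fin n) (Fin d) ℝ) (b : Fin n → ℝ) :
    ∃ x, (∀ y, cost M b x ≤ cost M b y) ∧
      ‖Matrix.toEuclideanLin M (WithLp.toLp 2 x)‖ ≤ l2norm b := by
  -- A preimage of the orthogonal projection of `b` onto the column space is optimal, and
  -- projections do not increase norms.
  set U := LinearMap.range (Matrix.toEuclideanLin M)
  obtain ⟨x, hx⟩ : U.starProjection (WithLp.toLp 2 b) ∈ U :=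
    Submodule.starProjection_apply_mem _ _
  refine ⟨x.ofLp, fun y => ?_, ?_⟩
  · rw [cost_eq_norm, cost_eq_norm, WithLp.toLp_ofLp, hx, norm_sub_rev,
      Submodule.starProjection_minimal, norm_sub_rev _ (WithLp.toLp 2 b)]
    exact ciInf_le ⟨0, by rintro _ ⟨_, rfl⟩; positivity⟩
      (⟨_, LinearMap.mem_range_self _ (WithLp.toLp 2 y)⟩ : U)
  · rw [WithLp.toLp_ofLp, hx]
    exact U.norm_starProjection_apply_le _

theorem exists_isOutput {s : ℕ} (h : Fin s → RowSample n d) : ∃ x, IsOutput h x := by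
  obtain ⟨x, hx, -⟩ := exists_leastSquares (sketchMatrix h) (sketchVector h)
  exact ⟨x, fun y _ => hx y⟩

/-- This half of `‖M‖₂ = σ₁` turns the operator norm in the estimate of `‖Q‖_F` into the numerator
of `κ`. -/
theorem specNorm_le_singularValues_zero (M : Matrix (Fin n) (Fin d) ℝ) :
    specNorm M ≤ (Matrix.toEuclideanLin M).singularValues 0 :=
  ContinuousLinearMap.opNorm_le_bound _ (LinearMap.singularValues_nonneg _ 0)
    fun x => norm_apply_le_singularValues_zero _ x

theorem norm_toEuclideanLin_le (M : Matrix (Fin n) (Fin d) ℝ) (x : EuclideanSpace ℝ (Fin d)) :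
    ‖Matrix.toEuclideanLin M x‖ ≤ specNorm M * ‖x‖ :=
  (Matrix.toEuclideanLin M).toContinuousLinearMap.le_opNorm x

/-- Each of the `d` columns is the image of a unit vector. -/
theorem frobNorm_sq_le_specNorm (M : Matrix (Fin n) (Fin d) ℝ) :
    frobNorm M ^ 2 ≤ d * specNorm M ^ 2 := by
  rw [frobNorm_sq, Finset.sum_comm]
  have key : ∀ j, ∑ i, M i j ^ 2 ≤ specNorm M ^ 2 := fun j => by
    have h := norm_toEuclideanLin_le M (EuclideanSpace.single j 1)
    rw [PiLp.norm_single, norm_one, mul_one] at h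
    refine le_trans (le_of_eq ?_) (pow_le_pow_left₀ (norm_nonneg _) h 2)
    rw [EuclideanSpace.norm_sq_eq]
    simp [Matrix.toLpLin_apply]
  calc _ ≤ ∑ _j : Fin d, specNorm M ^ 2 := Finset.sum_le_sum fun j _ => key j
    _ = _ := by simp

/-- The rank counts the positive singular values, so with numbering from `0` the one of index `d -
1` is still positive. -/
theorem singularValues_pos_of_rank {M : Matrix (Fin n) (Fin d) ℝ} (hd : 0 < d)
    (hM : M.rank = d) : 0 < (Matrix.toEuclideanLin M).singularValues (d - 1) := by
  have h := Matrix.rank_eq_finrank_range_toLin M (PiLp.basisFun 2 ℝ (Fin n))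
    (PiLp.basisFun 2 ℝ (Fin d))
  rw [← Matrix.toLpLin_eq_toLin, hM] at h
  rw [LinearMap.singularValues_pos_iff_lt_finrank_range]
  exact (Nat.sub_lt hd one_pos).trans_eq h

theorem one_le_condNumber {M : Matrix (Fin n) (Fin d) ℝ} (hd : 0 < d) (hM : M.rank = d) :
    1 ≤ condNumber M := by
  rw [condNumber, one_le_div (singularValues_pos_of_rank hd hM)]
  exact LinearMap.singularValues_antitone _ (Nat.zero_le _)

theorem specNorm_pos_of_rank {M : Matrix (Fin n) (Fin d) ℝ} (hd : 0 < d) (hM : M.rank = d) :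
    0 < specNorm M := by
  have hσ := singularValues_pos_of_rank hd hM
  have h := singularValues_last_mul_norm_le (Matrix.toEuclideanLin M) (m := d) (by simp)
    (EuclideanSpace.single ⟨0, hd⟩ 1)
  have h2 := norm_toEuclideanLin_le M (EuclideanSpace.single ⟨0, hd⟩ 1)
  rw [PiLp.norm_single, norm_one, mul_one] at h h2
  linarith

/-- The vector `(x, -1)`. -/
def extend (x : Fin d → ℝ) : Fin (d + 1) → ℝ := Fin.snoc (α := fun _ => ℝ) x (-1)

theorem dotProduct_extend (v : Fin (d + 1) → ℝ) (x : Fin d → ℝ) :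
    v ⬝ᵥ extend x = (fun k : Fin d => v k.castSucc) ⬝ᵥ x - v (Fin.last d) := by
  simp [dotProduct, Fin.sum_univ_castSucc, extend, sub_eq_add_neg]

theorem l2norm_extend_sq (x : Fin d → ℝ) : l2norm (extend x) ^ 2 = l2norm x ^ 2 + 1 := by
  simp [l2norm_sq, Fin.sum_univ_castSucc, extend]

/-- With the right-hand side as last column, a residual is the augmented matrix applied to `(x,
-1)`, so costs can be compared row by row. -/
theorem cost_sketch_sq {s : ℕ} (h : Fin s → RowSample n d) (x : Fin d → ℝ) :
    cost (sketchMatrix h) (sketchVector h) x ^ 2 =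
      ∑ t, (sampleMatrix h t ⬝ᵥ extend x) ^ 2 := by
  simp_rw [cost, l2norm_sq, dotProduct_extend]
  rfl

theorem cost_augment_sq (M : Matrix (Fin n) (Fin d) ℝ) (b : Fin n → ℝ) (x : Fin d → ℝ) :
    cost M b x ^ 2 = ∑ u, (augment M b u ⬝ᵥ extend x) ^ 2 := by
  simp_rw [cost, l2norm_sq, dotProduct_extend]
  simp [augment, Matrix.mulVec]

theorem frobNorm_augment_sq (M : Matrix (Fin n) (Fin d) ℝ) (b : Fin n → ℝ) :
    frobNorm (augment M b) ^ 2 = frobNorm M ^ 2 + l2norm b ^ 2 := by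
  simp [frobNorm_sq, l2norm_sq, augment, Fin.sum_univ_castSucc, Finset.sum_add_distrib]

/-- The additive error dominates `ε ‖Q‖_F ‖(x, -1)‖` at a least squares solution `x`. -/
theorem frobNorm_mul_extend_le {A : Matrix (Fin n) (Fin d) ℝ} {b : Fin n → ℝ} {ε : ℝ}
    (hd : 0 < d) (hA : (logMatrix A).rank = d) (hε : 0 ≤ ε) {x : Fin d → ℝ}
    (hx : ‖Matrix.toEuclideanLin (logMatrix A) (WithLp.toLp 2 x)‖ ≤ l2norm b) :
    ε * (frobNorm (augment (logMatrix A) b) * l2norm (extend x)) ≤ additiveError A b ε := by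
  set M := logMatrix A
  have hσ := singularValues_pos_of_rank hd hA
  have hσx := (singularValues_last_mul_norm_le (Matrix.toEuclideanLin M) (m := d) (by simp)
    (WithLp.toLp 2 x)).trans hx
  have hs := specNorm_pos_of_rank hd hA
  have hs0 := specNorm_le_singularValues_zero M
  have hF := frobNorm_sq_le_specNorm M
  have hQ := frobNorm_augment_sq M b
  rw [additiveError]
  refine mul_le_mul_of_nonneg_left ?_ hε
  change _ ≤ √(d + l2norm b ^ 2 / specNorm M ^ 2) * condNumber M * l2norm b
    + √(frobNorm M ^ 2 + l2norm b ^ 2)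
  have hext : l2norm (extend x) ≤ l2norm x + 1 := by
    refine le_of_sq_le_sq ?_ (by have := l2norm_nonneg x; positivity)
    rw [l2norm_extend_sq]
    nlinarith [l2norm_nonneg x]
  have hQ' : frobNorm (augment M b) = √(frobNorm M ^ 2 + l2norm b ^ 2) := by
    rw [← hQ, Real.sqrt_sq (frobNorm_nonneg _)]
  have hQle : √(frobNorm M ^ 2 + l2norm b ^ 2) ≤
      √(d + l2norm b ^ 2 / specNorm M ^ 2) * (Matrix.toEuclideanLin M).singularValues 0 := by
    -- Factor `‖M‖₂²` out of `d ‖M‖₂² + ‖b‖²`.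
    have h1 : √(frobNorm M ^ 2 + l2norm b ^ 2) ≤
        √(d + l2norm b ^ 2 / specNorm M ^ 2) * specNorm M := by
      rw [Real.sqrt_le_left (by positivity), mul_pow, Real.sq_sqrt (by positivity), add_mul,
        div_mul_cancel₀ _ (by positivity)]
      linarith
    exact h1.trans (mul_le_mul_of_nonneg_left hs0 (Real.sqrt_nonneg _))
  have hxb : l2norm x ≤ l2norm b / (Matrix.toEuclideanLin M).singularValues (d - 1) := by
    rw [le_div_iff₀ hσ, mul_comm]
    exact hσx
  calc frobNorm (augment M b) * l2norm (extend x)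
      ≤ frobNorm (augment M b) * (l2norm x + 1) :=
        mul_le_mul_of_nonneg_left hext (frobNorm_nonneg _)
    _ = √(frobNorm M ^ 2 + l2norm b ^ 2) * l2norm x + √(frobNorm M ^ 2 + l2norm b ^ 2) := by
        rw [hQ']; ring
    _ ≤ (√(d + l2norm b ^ 2 / specNorm M ^ 2) * (Matrix.toEuclideanLin M).singularValues 0) *
          (l2norm b / (Matrix.toEuclideanLin M).singularValues (d - 1))
          + √(frobNorm M ^ 2 + l2norm b ^ 2) := by
        have := LinearMap.singularValues_nonneg (Matrix.toEuclideanLin M) 0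
        have := l2norm_nonneg x
        gcongr
    _ = _ := by rw [condNumber]; ring

end LeastSquares

/-! ### A one-sided Chernoff bound -/

section Chernoff

variable {Ω : Type*} [MeasurableSpace Ω] {μ : Measure Ω} [IsProbabilityMeasure μ] {n s : ℕ}

/-- Since `g ≥ 0`, upper bounds on the point masses suffice. -/
theorem integral_comp_le_sum {U : Ω → Fin n} (hU : Measurable U) {q g : Fin n → ℝ}
    (hq : ∀ v, 0 ≤ q v) (hg : ∀ v, 0 ≤ g v)
    (hlaw : ∀ v, μ {ω | U ω = v} ≤ ENNReal.ofReal (q v)) :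
    ∫ ω, g (U ω) ∂μ ≤ ∑ v, q v * g v := by
  have hmap : ∫ ω, g (U ω) ∂μ = ∫ v, g v ∂(μ.map U) :=
    (integral_map hU.aemeasurable (measurable_of_finite g).aestronglyMeasurable).symm
  have := Measure.isProbabilityMeasure_map (μ := μ) hU.aemeasurable
  rw [hmap, integral_fintype Integrable.of_finite]
  refine Finset.sum_le_sum fun v _ => mul_le_mul_of_nonneg_right ?_ (hg v)
  rw [Measure.real, Measure.map_apply hU (measurableSet_singleton v)]
  exact ENNReal.toReal_le_of_le_ofReal (hq v) (hlaw v)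

/-- On `[0, 1]` one has `exp z ≤ 1 + z + z²`, and `g² ≤ g`, so the first moment alone bounds the
moment generating function. -/
theorem mgf_comp_le {U : Ω → Fin n} (hU : Measurable U) {q g : Fin n → ℝ}
    (hq : ∀ v, 0 ≤ q v) (hg : ∀ v, 0 ≤ g v) (hg1 : ∀ v, g v ≤ 1)
    (hlaw : ∀ v, μ {ω | U ω = v} ≤ ENNReal.ofReal (q v)) {w θ : ℝ}
    (hw : ∑ v, q v * g v ≤ w) (hθ : 0 ≤ θ) (hθ1 : θ ≤ 1) :
    mgf (fun ω => g (U ω)) μ θ ≤ Real.exp ((θ + θ ^ 2) * w) := by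
  have hint : ∀ k : Fin n → ℝ, Integrable (fun ω => k (U ω)) μ := fun k =>
    have := Measure.isProbabilityMeasure_map (μ := μ) hU.aemeasurable
    (Integrable.of_finite (μ := μ.map U) (f := k)).comp_measurable hU
  have hpt : ∀ v, Real.exp (θ * g v) ≤ 1 + (θ + θ ^ 2) * g v := fun v => by
    have h0 : 0 ≤ θ * g v := mul_nonneg hθ (hg v)
    have h1 : θ * g v ≤ 1 := mul_le_one₀ hθ1 (hg v) (hg1 v)
    have h2 := Real.abs_exp_sub_one_sub_id_le (abs_le.mpr ⟨by linarith, h1⟩)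
    have h3 : g v ^ 2 ≤ g v := by nlinarith [hg v, hg1 v]
    nlinarith [(abs_le.mp h2).2, mul_le_mul_of_nonneg_left h3 (sq_nonneg θ)]
  calc mgf (fun ω => g (U ω)) μ θ
      ≤ ∫ ω, (1 + (θ + θ ^ 2) * g (U ω)) ∂μ :=
        integral_mono (hint fun v => Real.exp (θ * g v))
          (hint fun v => 1 + (θ + θ ^ 2) * g v) fun ω => hpt (U ω)
    _ = 1 + (θ + θ ^ 2) * ∫ ω, g (U ω) ∂μ := by
        rw [integral_add (integrable_const _) ((hint g).const_mul _), integral_const_mul]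
        simp
    _ ≤ 1 + (θ + θ ^ 2) * w := by
        have := (integral_comp_le_sum hU hq hg hlaw).trans hw
        gcongr
    _ ≤ _ := by linarith [Real.add_one_le_exp ((θ + θ ^ 2) * w)]

/-- A multiplicative Chernoff bound in square root form. -/
theorem measure_sum_ge_le {U : Fin s → Ω → Fin n} (hU : ∀ t, Measurable (U t))
    (hind : iIndepFun U μ) {q g : Fin n → ℝ}
    (hq : ∀ v, 0 ≤ q v) (hg : ∀ v, 0 ≤ g v) (hg1 : ∀ v, g v ≤ 1)
    (hlaw : ∀ t v, μ {ω | U t ω = v} ≤ ENNReal.ofReal (q v)) {w η : ℝ}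
    (hw : ∑ v, q v * g v ≤ w) (hw0 : 0 ≤ w) (hη : 0 < η) :
    μ {ω | s * (√w + η) ^ 2 ≤ ∑ t, g (U t ω)} ≤ ENNReal.ofReal (Real.exp (-(s * η ^ 2))) := by
  have hr : 0 < √w + η := by positivity
  -- This Chernoff parameter is at most `1`, as the moment bound requires, and makes `θ (√w + η) =
  -- η`.
  set θ := η / (√w + η) with hθdef
  have hθ : 0 ≤ θ := by positivity
  have hθ1 : θ ≤ 1 := (div_le_one hr).mpr (by linarith [Real.sqrt_nonneg w])
  have hmeas : ∀ t, Measurable fun ω => g (U t ω) := fun t =>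
    (measurable_of_finite g).comp (hU t)
  have hsum : (fun ω => ∑ t, g (U t ω)) = ∑ t, fun ω => g (U t ω) := by
    ext ω; simp
  have hint : Integrable (fun ω => Real.exp (θ * ∑ t, g (U t ω))) μ := by
    refine Integrable.of_bound (C := Real.exp (θ * s))
      (by fun_prop) (Filter.Eventually.of_forall fun ω => ?_)
    rw [Real.norm_eq_abs, Real.abs_exp, Real.exp_le_exp]
    refine mul_le_mul_of_nonneg_left ?_ hθ
    calc ∑ t, g (U t ω) ≤ ∑ _t : Fin s, (1 : ℝ) := Finset.sum_le_sum fun t _ => hg1 _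
      _ = s := by simp
  have hmgf : mgf (fun ω => ∑ t, g (U t ω)) μ θ ≤ Real.exp (s * ((θ + θ ^ 2) * w)) := by
    have hind' : iIndepFun (fun t ω => g (U t ω)) μ :=
      hind.comp (fun _ => g) fun _ => measurable_of_finite g
    rw [hsum, hind'.mgf_sum hmeas]
    calc ∏ t, mgf (fun ω => g (U t ω)) μ θ
        ≤ ∏ _t : Fin s, Real.exp ((θ + θ ^ 2) * w) :=
          Finset.prod_le_prod (fun _ _ => mgf_nonneg)
            fun t _ => mgf_comp_le (hU t) hq hg hg1 (hlaw t) hw hθ hθ1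
      _ = _ := by rw [Finset.prod_const, Finset.card_univ, Fintype.card_fin, Real.exp_nat_mul]
  have hch := measure_ge_le_exp_mul_mgf (s * (√w + η) ^ 2) hθ hint
  rw [← ofReal_measureReal]
  refine ENNReal.ofReal_le_ofReal (hch.trans ?_)
  refine (mul_le_mul_of_nonneg_left hmgf (Real.exp_pos _).le).trans ?_
  rw [← Real.exp_add, Real.exp_le_exp]
  have hsq : √w ^ 2 = w := Real.sq_sqrt hw0
  have hθr : θ * (√w + η) = η := div_mul_cancel₀ _ hr.ne'
  have hθw : θ * √w ≤ η := by nlinarith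
  -- The difference of the two sides is `θ √w (η - θ √w)`, and `0 ≤ θ √w ≤ η`.
  have key : η ^ 2 ≤ θ * (√w + η) ^ 2 - (θ + θ ^ 2) * w := by
    have e : θ * (√w + η) ^ 2 - (θ + θ ^ 2) * w
        = θ * (√w + η) * (√w + η) - θ * √w * √w - (θ * √w) * (θ * √w) := by
      rw [← hsq]; simp only [Real.sqrt_sq (Real.sqrt_nonneg w)]; ring
    have h1 : θ * √w * √w = η * √w - η * (θ * √w) := by
      have : θ * √w = η - θ * η := by linarith
      calc θ * √w * √w = (η - θ * η) * √w := by rw [this]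
        _ = _ := by ring
    rw [e, hθr, h1]
    nlinarith [mul_nonneg hθ (Real.sqrt_nonneg w)]
  nlinarith [mul_le_mul_of_nonneg_left key (Nat.cast_nonneg (α := ℝ) s)]

end Chernoff

/-! ### From good samples to the regression guarantee -/

section Sampling

variable {n d s : ℕ}

/-- The squared cosine of the angle between row `v` of `Q` and the vector `y`. -/
noncomputable def rowCosSq {m : ℕ} (Q : Matrix (Fin n) (Fin m) ℝ) (y : Fin m → ℝ) (v : Fin n) : ℝ :=
  (Q v ⬝ᵥ y) ^ 2 / (l2norm (Q v) * l2norm y) ^ 2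

theorem rowCosSq_nonneg {m : ℕ} (Q : Matrix (Fin n) (Fin m) ℝ) (y : Fin m → ℝ) (v : Fin n) :
    0 ≤ rowCosSq Q y v := by unfold rowCosSq; positivity

theorem rowCosSq_le_one {m : ℕ} (Q : Matrix (Fin n) (Fin m) ℝ) (y : Fin m → ℝ) (v : Fin n) :
    rowCosSq Q y v ≤ 1 := by
  refine div_le_one_of_le₀ ?_ (sq_nonneg _)
  rw [← sq_abs]
  exact pow_le_pow_left₀ (abs_nonneg _) (abs_dotProduct_le _ _) 2

/-- A vanishing norm makes the inner product vanish too, so the convention `0 / 0 = 0` does no harm.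
-/
theorem sq_dotProduct_eq {m : ℕ} (Q : Matrix (Fin n) (Fin m) ℝ) (y : Fin m → ℝ) (v : Fin n) :
    (Q v ⬝ᵥ y) ^ 2 = (l2norm (Q v) * l2norm y) ^ 2 * rowCosSq Q y v := by
  rcases eq_or_ne (l2norm (Q v) * l2norm y) 0 with h | h
  · have h0 := abs_dotProduct_le (Q v) y
    rw [h] at h0
    rw [h, abs_nonpos_iff.mp h0]
    simp
  · rw [rowCosSq, mul_div_cancel₀ _ (pow_ne_zero 2 h)]

theorem rowProb_nonneg {m : ℕ} (Q : Matrix (Fin n) (Fin m) ℝ) (v : Fin n) : 0 ≤ rowProb Q v := by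
  unfold rowProb; positivity

/-- The factor `‖Q_v‖²` of the probability cancels the one in the denominator of the cosine; this is
what squared-norm sampling achieves. -/
theorem sum_rowProb_mul_rowCosSq {m : ℕ} {Q : Matrix (Fin n) (Fin m) ℝ} {y : Fin m → ℝ}
    (hQ : 0 < frobNorm Q) (hy : 0 < l2norm y) :
    ∑ v, rowProb Q v * rowCosSq Q y v = (∑ v, (Q v ⬝ᵥ y) ^ 2) / (frobNorm Q * l2norm y) ^ 2 := by
  rw [Finset.sum_div]
  refine Finset.sum_congr rfl fun v _ => ?_
  rw [sq_dotProduct_eq, rowProb]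
  field_simp

/-- The effect of a good sample on a vector `y`. -/
theorem abs_sampleMatrix_dotProduct_le {γ : ℝ} {Q : Matrix (Fin n) (Fin (d + 1)) ℝ}
    {h : Fin s → RowSample n d} {t : Fin s} (hgood : IsGoodSample γ Q (h t)) (hγ : 0 ≤ γ)
    (hγ1 : γ < 1) (hQ : 0 < frobNorm Q) (y : Fin (d + 1) → ℝ) :
    |sampleMatrix h t ⬝ᵥ y| ≤ frobNorm Q * l2norm y / √(s * (1 - γ)) *
      (√(rowCosSq Q y (h t).index) + γ) := by
  obtain ⟨hp, hrow⟩ := hgood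
  set v := (h t).index
  have hs : 0 < s := t.pos
  have hT : sampleMatrix h t ⬝ᵥ y = ((h t).row ⬝ᵥ y) / √(s * (h t).prob) := by
    simp only [dotProduct, sampleMatrix, Matrix.of_apply, Finset.sum_div]
    exact Finset.sum_congr rfl fun k _ => by ring
  have hdot : |(h t).row ⬝ᵥ y| ≤ l2norm (Q v) * l2norm y * (√(rowCosSq Q y v) + γ) := by
    have e : (h t).row ⬝ᵥ y = Q v ⬝ᵥ y + (fun k => (h t).row k - Q v k) ⬝ᵥ y := by
      simp only [dotProduct, ← Finset.sum_add_distrib]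
      exact Finset.sum_congr rfl fun k _ => by ring
    have h1 : |Q v ⬝ᵥ y| = l2norm (Q v) * l2norm y * √(rowCosSq Q y v) := by
      rw [← Real.sqrt_sq_eq_abs, sq_dotProduct_eq, Real.sqrt_mul (sq_nonneg _),
        Real.sqrt_sq (mul_nonneg (l2norm_nonneg _) (l2norm_nonneg _))]
    have h2 := (abs_dotProduct_le (fun k => (h t).row k - Q v k) y).trans
      (mul_le_mul_of_nonneg_right hrow (l2norm_nonneg y))
    rw [e]
    refine (abs_add_le _ _).trans ?_
    rw [h1]
    linarith
  have hrhs : 0 ≤ frobNorm Q * l2norm y / √(s * (1 - γ)) * (√(rowCosSq Q y v) + γ) := by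
    have := l2norm_nonneg y
    positivity
  rw [hT, abs_div, abs_of_nonneg (Real.sqrt_nonneg _)]
  -- Relative noise on a zero row is zero, so such a sample contributes nothing whatever its
  -- returned probability.
  rcases (l2norm_nonneg (Q v)).eq_or_lt with h0 | h0
  · rw [← h0] at hdot
    rw [abs_nonpos_iff.mp (hdot.trans (by simp)), abs_zero, zero_div]
    exact hrhs
  · have hp' : (1 - γ) * rowProb Q v ≤ (h t).prob := by linarith [(abs_le.mp hp).1]
    have hpos : 0 < rowProb Q v := by unfold rowProb; positivity
    have h1γ : 0 < 1 - γ := by linarith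
    have hs' : (0 : ℝ) < s := by exact_mod_cast hs
    -- As `√p_v = ‖Q_v‖ / ‖Q‖_F`, the rescaling removes the row norm.
    have hsqrt : √(s * (1 - γ)) * (l2norm (Q v) / frobNorm Q) ≤ √(s * (h t).prob) := by
      have e : l2norm (Q v) / frobNorm Q = √(rowProb Q v) := by
        rw [rowProb, ← div_pow, Real.sqrt_sq (by positivity)]
      rw [e, ← Real.sqrt_mul (by positivity)]
      refine Real.sqrt_le_sqrt ?_
      rw [mul_assoc]
      exact mul_le_mul_of_nonneg_left hp' hs'.le
    have hden : 0 < √(s * (1 - γ)) * (l2norm (Q v) / frobNorm Q) := by positivity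
    calc |(h t).row ⬝ᵥ y| / √(s * (h t).prob)
        ≤ (l2norm (Q v) * l2norm y * (√(rowCosSq Q y v) + γ)) /
            (√(s * (1 - γ)) * (l2norm (Q v) / frobNorm Q)) :=
          div_le_div₀ ((abs_nonneg _).trans hdot) hdot hden hsqrt
      _ = _ := by field_simp

/-- If the samples are good and the squared cosines have mean at most `a²`, the sketched cost is
controlled. -/
theorem cost_sketch_le {γ a : ℝ} {Q : Matrix (Fin n) (Fin (d + 1)) ℝ}
    {h : Fin s → RowSample n d} (hgood : ∀ t, IsGoodSample γ Q (h t)) (hγ : 0 ≤ γ)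
    (hγ1 : γ < 1) (hQ : 0 < frobNorm Q) (hs : 0 < s) (ha : 0 ≤ a) (x : Fin d → ℝ)
    (hsum : ∑ t, rowCosSq Q (extend x) (h t).index ≤ s * a ^ 2) :
    cost (sketchMatrix h) (sketchVector h) x ≤
      frobNorm Q * l2norm (extend x) * (a + γ) / √(1 - γ) := by
  have h1γ : 0 < 1 - γ := by linarith
  have hs' : (0 : ℝ) < s := by exact_mod_cast hs
  have hy := l2norm_nonneg (extend x)
  set g := fun t => rowCosSq Q (extend x) (h t).index
  have hg : ∀ t, 0 ≤ g t := fun t => rowCosSq_nonneg _ _ _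
  -- Cauchy–Schwarz handles the cross term in `(√g + γ)²`.
  have hcs : ∑ t, √(g t) ≤ s * a := by
    refine le_of_sq_le_sq ?_ (by positivity)
    have := sq_sum_le_card_mul_sum_sq (s := Finset.univ) (f := fun t => √(g t))
    simp only [Real.sq_sqrt (hg _), Finset.card_univ, Fintype.card_fin] at this
    calc _ ≤ _ := this
      _ ≤ s * (s * a ^ 2) := by gcongr
      _ = _ := by ring
  have hsq : ∑ t, (√(g t) + γ) ^ 2 ≤ s * (a + γ) ^ 2 := by
    have e : ∑ t, (√(g t) + γ) ^ 2 = ∑ t, g t + 2 * γ * ∑ t, √(g t) + s * γ ^ 2 := by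
      simp only [add_sq, Real.sq_sqrt (hg _), Finset.sum_add_distrib, Finset.mul_sum]
      simp
      exact Finset.sum_congr rfl fun t _ => by ring
    rw [e]
    have := mul_le_mul_of_nonneg_left hcs (by positivity : 0 ≤ 2 * γ)
    linarith [show s * (a + γ) ^ 2 = s * a ^ 2 + 2 * γ * (s * a) + s * γ ^ 2 by ring]
  refine le_of_sq_le_sq ?_ (by positivity)
  rw [cost_sketch_sq]
  calc ∑ t, (sampleMatrix h t ⬝ᵥ extend x) ^ 2
      ≤ ∑ t, (frobNorm Q * l2norm (extend x) / √(s * (1 - γ)) * (√(g t) + γ)) ^ 2 := by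
        refine Finset.sum_le_sum fun t _ => ?_
        rw [← sq_abs]
        exact pow_le_pow_left₀ (abs_nonneg _)
          (abs_sampleMatrix_dotProduct_le (hgood t) hγ hγ1 hQ _) 2
    _ = (frobNorm Q * l2norm (extend x)) ^ 2 / (s * (1 - γ)) * ∑ t, (√(g t) + γ) ^ 2 := by
        rw [Finset.mul_sum]
        refine Finset.sum_congr rfl fun t _ => ?_
        rw [mul_pow, div_pow, Real.sq_sqrt (by positivity)]
    _ ≤ (frobNorm Q * l2norm (extend x)) ^ 2 / (s * (1 - γ)) * (s * (a + γ) ^ 2) := by gcongr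
    _ = _ := by
        rw [div_pow, Real.sq_sqrt h1γ.le]
        field_simp

theorem frobNorm_augment_pos {M : Matrix (Fin n) (Fin d) ℝ} (b : Fin n → ℝ) (hd : 0 < d)
    (hM : M.rank = d) : 0 < frobNorm (augment M b) := by
  refine lt_of_le_of_ne (frobNorm_nonneg _) fun h0 => ?_
  have h1 := frobNorm_augment_sq M b
  rw [← h0] at h1
  have h2 : frobNorm M ^ 2 = 0 := by nlinarith [sq_nonneg (frobNorm M), sq_nonneg (l2norm b)]
  rw [frobNorm_sq] at h2
  have hz : M = 0 := by
    ext i j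
    have h3 := (Finset.sum_eq_zero_iff_of_nonneg fun i _ =>
      Finset.sum_nonneg fun j _ => sq_nonneg (M i j)).mp h2 i (Finset.mem_univ i)
    have h4 := (Finset.sum_eq_zero_iff_of_nonneg fun j _ => sq_nonneg (M i j)).mp h3 j
      (Finset.mem_univ j)
    exact pow_eq_zero_iff two_ne_zero |>.mp h4
  rw [hz, Matrix.rank_zero] at hM
  omega

/-- The Chernoff bound is applied to the squared cosines with `(x, -1)`, where `x` is one optimal
solution fixed before sampling. Off its exceptional event, minimality of an output compares it with
`x`. -/
theorem measure_not_regressionGuarantee_le {Ω : Type u} [MeasurableSpace Ω] {μ : Measure Ω}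
    [IsProbabilityMeasure μ] {A : Matrix (Fin n) (Fin d) ℝ} {b : Fin n → ℝ} {ε : ℝ}
    (hd : 0 < d) (hA : (logMatrix A).rank = d) (hε : 0 < ε) (hε1 : ε < 1) (hs : 0 < s)
    {h : Fin s → Ω → RowSample n d}
    (H : GoodSampling μ (1 / 4 * ε) (augment (logMatrix A) b) h) :
    μ {ω | ¬ RegressionGuarantee A b ε fun t => h t ω} ≤
      ENNReal.ofReal (Real.exp (-(s * (ε / 4) ^ 2))) := by
  obtain ⟨x, hx, hxb⟩ := exists_leastSquares (logMatrix A) b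
  have hΔ := frobNorm_mul_extend_le hd hA hε.le hxb
  have hQ := frobNorm_augment_pos b hd hA
  set Q := augment (logMatrix A) b
  have hy : 0 < l2norm (extend x) := by
    have h1 := l2norm_extend_sq x
    have h2 := l2norm_nonneg (extend x)
    rcases h2.eq_or_lt with h3 | h3
    · rw [← h3] at h1
      nlinarith [sq_nonneg (l2norm x)]
    · exact h3
  set R := frobNorm Q * l2norm (extend x) with hR
  have hRpos : 0 < R := by positivity
  have hcost : 0 ≤ cost (logMatrix A) b x := l2norm_nonneg _
  set w := (1 + 1 / 4 * ε) * (cost (logMatrix A) b x / R) ^ 2 with hw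
  have hw0 : 0 ≤ w := by positivity
  have hsum : ∑ v, (1 + 1 / 4 * ε) * rowProb Q v * rowCosSq Q (extend x) v ≤ w := by
    simp_rw [mul_assoc]
    rw [← Finset.mul_sum, sum_rowProb_mul_rowCosSq hQ hy, ← cost_augment_sq, hw, div_pow]
  have hch := measure_sum_ge_le H.measurable_index H.indep
    (fun v => mul_nonneg (by positivity) (rowProb_nonneg Q v))
    (rowCosSq_nonneg Q (extend x)) (rowCosSq_le_one Q (extend x)) H.law hsum hw0
    (by positivity : 0 < ε / 4)
  -- Almost surely failure implies the Chernoff event; measurability of the failure set is not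
  -- needed.
  refine (measure_mono_ae ?_).trans hch
  filter_upwards [H.good] with ω hω hbad
  by_contra hlt
  refine hbad ⟨exists_isOutput _, fun z hz => ?_⟩
  have hlt' := (not_le.mp hlt).le
  have h1 := cost_sketch_le (h := fun t => h t ω) hω (by positivity) (by linarith) hQ hs
    (by positivity) x hlt'
  have h2 : cost (sketchMatrix fun t => h t ω) (sketchVector fun t => h t ω) z ≤ _ :=
    (hz (Set.mem_univ x)).trans h1
  have hinf : cost (logMatrix A) b x ≤ ⨅ y, cost (logMatrix A) b y := le_ciInf hx
  have hRw : R * √w ≤ (1 + ε / 4) * cost (logMatrix A) b x := by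
    have e : R * √w = √(1 + 1 / 4 * ε) * cost (logMatrix A) b x := by
      rw [hw, Real.sqrt_mul (by positivity), Real.sqrt_sq (by positivity)]
      field_simp
    rw [e]
    refine mul_le_mul_of_nonneg_right ?_ hcost
    rw [Real.sqrt_le_left (by positivity)]
    nlinarith
  have hinv : 1 / √(1 - 1 / 4 * ε) ≤ 1 + ε / 4 := by
    have hpos : 0 < 1 - 1 / 4 * ε := by linarith
    rw [div_le_iff₀ (Real.sqrt_pos.mpr hpos)]
    refine le_of_sq_le_sq ?_ (by positivity)
    rw [mul_pow, Real.sq_sqrt hpos.le]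
    nlinarith [mul_pos hε hε, mul_pos (mul_pos hε hε) hε]
  -- One `ε/4` is the deviation, the other the row noise. The rest fits because `(1 + ε/4)² ≤ 1 + ε`
  -- and `(1 + ε/4) / 2 ≤ 1`.
  calc _ ≤ R * (√w + ε / 4 + 1 / 4 * ε) / √(1 - 1 / 4 * ε) := h2
    _ = (R * √w + ε / 2 * R) * (1 / √(1 - 1 / 4 * ε)) := by ring
    _ ≤ ((1 + ε / 4) * cost (logMatrix A) b x + ε / 2 * R) * (1 + ε / 4) := by gcongr
    _ = (1 + ε / 4) ^ 2 * cost (logMatrix A) b x + (1 + ε / 4) / 2 * (ε * R) := by ring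
    _ ≤ (1 + ε) * cost (logMatrix A) b x + 1 * (ε * R) := by
        gcongr
        · nlinarith
        · linarith
    _ ≤ _ := by
        rw [one_mul]
        gcongr

/-- Already `s ≥ (16 / ε²) log (1/δ)` suffices, with `16` cancelling `(1/4)²`; the factors `d κ² ≥
1` and `log (d/δ) ≥ log (1/δ)` only help. -/
theorem exp_neg_le_of_sampleSize {κ ε δ : ℝ} (hd : 0 < d) (hκ : 1 ≤ κ) (hε : 0 < ε)
    (hδ : 0 < δ) (hδ1 : δ < 1)
    (hs : s = ⌈16 * (d * κ ^ 2 / ε ^ 2) * Real.log (d / δ)⌉₊) :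
    0 < s ∧ Real.exp (-(s * (ε / 4) ^ 2)) ≤ δ := by
  have hd' : (1 : ℝ) ≤ d := by exact_mod_cast hd
  have hlog : Real.log (1 / δ) ≤ Real.log (d / δ) :=
    Real.log_le_log (by positivity) (by gcongr)
  have hlog0 : 0 < Real.log (1 / δ) := Real.log_pos ((one_lt_div hδ).mpr hδ1)
  have hκ2 : 1 ≤ κ ^ 2 := one_le_pow₀ hκ
  have hle : 16 / ε ^ 2 * Real.log (1 / δ) ≤ s := by
    rw [hs]
    refine le_trans ?_ (Nat.le_ceil _)
    refine mul_le_mul ?_ hlog hlog0.le (by positivity)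
    rw [mul_div_assoc']
    gcongr
    nlinarith
  refine ⟨?_, ?_⟩
  · have : (0 : ℝ) < s := lt_of_lt_of_le (by positivity) hle
    exact_mod_cast this
  · have h1 : Real.log (1 / δ) ≤ s * (ε / 4) ^ 2 := by
      calc Real.log (1 / δ) = 16 / ε ^ 2 * Real.log (1 / δ) * (ε / 4) ^ 2 := by
            field_simp; norm_num
        _ ≤ _ := by gcongr
    calc _ ≤ Real.exp (-Real.log (1 / δ)) := Real.exp_le_exp.mpr (by linarith)
      _ = δ := by rw [one_div, Real.log_inv, neg_neg, Real.exp_log hδ]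

end Sampling

/-! ### Sample count against the main term of the space -/

section Space

/-- The parameters on which the space depends. -/
structure SpaceParam where
  n : ℕ
  d : ℕ
  κ : ℝ
  ε : ℝ
  δ : ℝ
  n_pos : 0 < n
  d_pos : 0 < d
  one_le_κ : 1 ≤ κ
  ε_pos : 0 < ε
  ε_lt_one : ε < 1
  δ_pos : 0 < δ
  δ_lt_one : δ < 1

namespace SpaceParam

variable (p : SpaceParam)

/-- The number of samples. -/
noncomputable def samples : ℕ := ⌈16 * (p.d * p.κ ^ 2 / p.ε ^ 2) * Real.log (p.d / p.δ)⌉₊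

/-- The main term `d² κ² max {1, log (1 / δ)}` of the space bound. -/
noncomputable def main : ℝ := p.d ^ 2 * p.κ ^ 2 * max 1 (Real.log (1 / p.δ))

/-- The quantity whose powers are the lower order factors of the space bound. -/
noncomputable def base : ℝ := Real.log (2 + p.main) * (Real.log (2 + p.n) / p.ε)

theorem one_le_d : (1 : ℝ) ≤ p.d := by exact_mod_cast p.d_pos

theorem one_le_n : (1 : ℝ) ≤ p.n := by exact_mod_cast p.n_pos

theorem d_le_main : (p.d : ℝ) ≤ p.main := by
  have h1 := p.one_le_d
  have h2 : 1 ≤ p.κ ^ 2 := one_le_pow₀ p.one_le_κ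
  have h3 : 1 ≤ max 1 (Real.log (1 / p.δ)) := le_max_left _ _
  calc (p.d : ℝ) ≤ p.d ^ 2 * 1 * 1 := by nlinarith
    _ ≤ _ := by unfold main; gcongr

theorem one_le_main : 1 ≤ p.main := p.one_le_d.trans p.d_le_main

theorem one_le_log_two_add {x : ℝ} (hx : 1 ≤ x) : 1 ≤ Real.log (2 + x) := by
  rw [Real.le_log_iff_exp_le (by linarith)]
  linarith [Real.exp_one_lt_d9]

theorem one_le_log_main : 1 ≤ Real.log (2 + p.main) := one_le_log_two_add p.one_le_main

theorem one_le_log_n : 1 ≤ Real.log (2 + p.n) := one_le_log_two_add p.one_le_n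

theorem one_le_inv_ε : 1 ≤ 1 / p.ε := (one_le_div p.ε_pos).mpr p.ε_lt_one.le

theorem base_eq : p.base = Real.log (2 + p.main) * Real.log (2 + p.n) * (1 / p.ε) := by
  unfold base; ring

theorem one_le_base : 1 ≤ p.base := by
  rw [base_eq]
  exact one_le_mul_of_one_le_of_one_le
    (one_le_mul_of_one_le_of_one_le p.one_le_log_main p.one_le_log_n) p.one_le_inv_ε

theorem log_main_mul_inv_ε_le_base : Real.log (2 + p.main) * (1 / p.ε) ≤ p.base := by
  have h1 := p.one_le_log_main
  have h2 := p.one_le_inv_ε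
  rw [base_eq, mul_right_comm]
  exact le_mul_of_one_le_right (by positivity) p.one_le_log_n

theorem log_n_le_base : Real.log (2 + p.n) ≤ p.base := by
  have h1 := p.one_le_log_n
  rw [base_eq]
  have h2 : Real.log (2 + p.n) ≤ Real.log (2 + p.main) * Real.log (2 + p.n) :=
    le_mul_of_one_le_left (by linarith) p.one_le_log_main
  exact h2.trans (le_mul_of_one_le_right (by linarith) p.one_le_inv_ε)

theorem log_main_le_base : Real.log (2 + p.main) ≤ p.base :=
  (le_mul_of_one_le_right (by linarith [p.one_le_log_main]) p.one_le_inv_ε).trans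
    p.log_main_mul_inv_ε_le_base

theorem inv_ε_le_base : 1 / p.ε ≤ p.base :=
  (le_mul_of_one_le_left (by linarith [p.one_le_inv_ε]) p.one_le_log_main).trans
    p.log_main_mul_inv_ε_le_base

theorem samples_pos : 0 < p.samples :=
  (exp_neg_le_of_sampleSize p.d_pos p.one_le_κ p.ε_pos p.δ_pos p.δ_lt_one rfl).1

/-- One factor `d` comes from `s`, the other from `d + 1 ≤ 2 d`. The constant is `16 · 2 · 2` from
the sample size, the logarithm and `d + 1`, plus `2` from the ceiling. -/
theorem samples_mul_le : (p.samples : ℝ) * (p.d + 1) ≤ 66 * (p.main * p.base ^ 2) := by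
  have hd := p.one_le_d
  have hdX := p.d_le_main
  have hX := p.one_le_main
  have hZ := p.one_le_log_main
  have hB := p.one_le_base
  have hi := p.one_le_inv_ε
  have hZB := p.log_main_mul_inv_ε_le_base
  set m := max 1 (Real.log (1 / p.δ)) with hm
  have hm1 : 1 ≤ m := le_max_left _ _
  have hδ := p.δ_pos
  have hlog : Real.log (p.d / p.δ) ≤ 2 * (Real.log (2 + p.main) * m) := by
    have e : Real.log (p.d / p.δ) = Real.log p.d + Real.log (1 / p.δ) := by
      rw [← Real.log_mul (by positivity) (by positivity)]
      ring_nf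
    have h1 : Real.log p.d ≤ Real.log (2 + p.main) :=
      Real.log_le_log (by linarith) (by linarith)
    have h2 : Real.log (1 / p.δ) ≤ m := le_max_right _ _
    rw [e]
    nlinarith
  have hlog0 : 0 ≤ Real.log (p.d / p.δ) :=
    Real.log_nonneg ((one_le_div hδ).mpr (by linarith [p.δ_lt_one]))
  have hs : (p.samples : ℝ) ≤ 16 * (p.d * p.κ ^ 2 / p.ε ^ 2) * Real.log (p.d / p.δ) + 1 :=
    (Nat.ceil_lt_add_one (mul_nonneg (by positivity) hlog0)).le
  have hXm : p.main = p.d ^ 2 * p.κ ^ 2 * m := rfl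
  have hZ2 : Real.log (2 + p.main) * (1 / p.ε) ^ 2 ≤ p.base ^ 2 := by
    calc Real.log (2 + p.main) * (1 / p.ε) ^ 2
        ≤ Real.log (2 + p.main) ^ 2 * (1 / p.ε) ^ 2 := by
          gcongr
          exact le_self_pow₀ hZ two_ne_zero
      _ = (Real.log (2 + p.main) * (1 / p.ε)) ^ 2 := by ring
      _ ≤ _ := by gcongr
  calc (p.samples : ℝ) * (p.d + 1)
      ≤ (16 * (p.d * p.κ ^ 2 / p.ε ^ 2) * (2 * (Real.log (2 + p.main) * m)) + 1) *
          (2 * p.d) := by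
        refine mul_le_mul (hs.trans ?_) (by linarith) (by positivity) (by positivity)
        gcongr
    _ = 64 * (p.main * (Real.log (2 + p.main) * (1 / p.ε) ^ 2)) + 2 * p.d := by
        rw [show p.main * (Real.log (2 + p.main) * (1 / p.ε) ^ 2)
          = p.d ^ 2 * p.κ ^ 2 * m * (Real.log (2 + p.main) * (1 / p.ε) ^ 2) by rw [← hXm]]
        ring
    _ ≤ 64 * (p.main * p.base ^ 2) + 2 * (p.main * p.base ^ 2) := by
        have : p.main ≤ p.main * p.base ^ 2 :=
          le_mul_of_one_le_right (by linarith) (one_le_pow₀ hB)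
        gcongr
        linarith
    _ = _ := by ring

end SpaceParam

/-! ### Polynomial growth of the sketch sizes -/

/-- The function `u` is bounded by a polynomial in `SpaceParam.base`. -/
def PolyBounded (u : SpaceParam → ℝ) : Prop :=
  ∃ B > (0 : ℝ), ∃ a : ℕ, ∀ p, |u p| ≤ B * p.base ^ a

namespace PolyBounded

variable {u v : SpaceParam → ℝ}

theorem mono (hv : PolyBounded v) (h : ∀ p, |u p| ≤ |v p|) : PolyBounded u := by
  obtain ⟨B, hB, a, ha⟩ := hv
  exact ⟨B, hB, a, fun p => (h p).trans (ha p)⟩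

theorem const (r : ℝ) : PolyBounded fun _ => r :=
  ⟨|r| + 1, by positivity, 0, fun p => by simp⟩

theorem base : PolyBounded SpaceParam.base :=
  ⟨1, one_pos, 1, fun p => by
    rw [abs_of_nonneg (by linarith [p.one_le_base])]; simp⟩

theorem add (hu : PolyBounded u) (hv : PolyBounded v) : PolyBounded fun p => u p + v p := by
  obtain ⟨B, hB, a, ha⟩ := hu
  obtain ⟨B', hB', a', ha'⟩ := hv
  refine ⟨B + B', by positivity, a + a', fun p => (abs_add_le _ _).trans ?_⟩
  have h1 := p.one_le_base
  have h2 : p.base ^ a ≤ p.base ^ (a + a') := pow_le_pow_right₀ h1 (by omega)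
  have h3 : p.base ^ a' ≤ p.base ^ (a + a') := pow_le_pow_right₀ h1 (by omega)
  nlinarith [ha p, ha' p]

theorem mul (hu : PolyBounded u) (hv : PolyBounded v) : PolyBounded fun p => u p * v p := by
  obtain ⟨B, hB, a, ha⟩ := hu
  obtain ⟨B', hB', a', ha'⟩ := hv
  refine ⟨B * B', by positivity, a + a', fun p => ?_⟩
  have h1 := p.one_le_base
  rw [abs_mul, pow_add]
  calc |u p| * |v p| ≤ (B * p.base ^ a) * (B' * p.base ^ a') :=
        mul_le_mul (ha p) (ha' p) (abs_nonneg _) (by positivity)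
    _ = _ := by ring

theorem pow (hu : PolyBounded u) (k : ℕ) : PolyBounded fun p => u p ^ k := by
  induction k with
  | zero => simpa using const 1
  | succ k ih => simpa only [pow_succ] using ih.mul hu

/-- Uses `⌈u⌉₊ ≤ |u| + 1 ≤ u² + 2`, which is free of absolute values. -/
theorem natCeil (hu : PolyBounded u) : PolyBounded fun p => (⌈u p⌉₊ : ℝ) := by
  refine ((hu.mul hu).add (const 2)).mono fun p => ?_
  rw [abs_of_nonneg (Nat.cast_nonneg _), abs_of_nonneg (by nlinarith [mul_self_nonneg (u p)])]
  have h1 := Nat.ceil_le_ceil (le_abs_self (u p))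
  have h2 : (⌈u p⌉₊ : ℝ) ≤ ⌈|u p|⌉₊ := by exact_mod_cast h1
  have h3 := Nat.ceil_lt_add_one (abs_nonneg (u p))
  nlinarith [sq_nonneg (|u p| - 1), abs_mul_abs_self (u p)]

theorem log (hu : PolyBounded u) (h1 : ∀ p, 1 ≤ u p) : PolyBounded fun p => Real.log (u p) :=
  hu.mono fun p => by
    have := h1 p
    rw [abs_of_nonneg (Real.log_nonneg this), abs_of_nonneg (by linarith)]
    linarith [Real.log_le_sub_one_of_pos (by linarith : 0 < u p)]

theorem inv_ε : PolyBounded fun p => 1 / p.ε :=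
  base.mono fun p => by
    rw [abs_of_nonneg (by linarith [p.one_le_inv_ε]), abs_of_nonneg (by linarith [p.one_le_base])]
    exact p.inv_ε_le_base

theorem log_n : PolyBounded fun p => Real.log p.n :=
  base.mono fun p => by
    have h := p.one_le_n
    rw [abs_of_nonneg (Real.log_nonneg h), abs_of_nonneg (by linarith [p.one_le_base])]
    exact (Real.log_le_log (by linarith) (by linarith)).trans p.log_n_le_base

theorem log_main : PolyBounded fun p => Real.log p.main :=
  base.mono fun p => by
    have h := p.one_le_main
    rw [abs_of_nonneg (Real.log_nonneg h), abs_of_nonneg (by linarith [p.one_le_base])]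
    exact (Real.log_le_log (by linarith) (by linarith)).trans p.log_main_le_base

/-- The repetitions depend on `s` through the failure probability. Only `log s` enters, which is why
`log (2 + X)` in the base is enough. -/
theorem log_samples : PolyBounded fun p => Real.log p.samples := by
  refine (((const (Real.log 66)).add log_main).add
    ((base.pow 2).log fun p => one_le_pow₀ p.one_le_base)).mono fun p => ?_
  have h1 := p.one_le_main
  have h2 : 1 ≤ p.base ^ 2 := one_le_pow₀ p.one_le_base
  have hs : (1 : ℝ) ≤ p.samples := by exact_mod_cast p.samples_pos
  have hle : (p.samples : ℝ) ≤ 66 * (p.main * p.base ^ 2) :=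
    (le_mul_of_one_le_right (by linarith) (by linarith [p.one_le_d])).trans p.samples_mul_le
  have e : Real.log 66 + Real.log p.main + Real.log (p.base ^ 2)
      = Real.log (66 * (p.main * p.base ^ 2)) := by
    rw [Real.log_mul (by norm_num) (by positivity), Real.log_mul (by positivity) (by positivity)]
    ring
  rw [e]
  exact abs_le_abs_of_nonneg (Real.log_nonneg hs) (Real.log_le_log (by linarith) hle)

variable (c : SketchConst)

theorem levels : PolyBounded fun p => ((c.size p.n p.samples p.ε).levels : ℝ) := by
  have h : PolyBounded fun p => Real.logb 2 (c.K * p.n / (c.acc * p.ε)) := by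
    refine ((((const (Real.log (c.K / c.acc))).add log_n).add
      (inv_ε.log fun p => p.one_le_inv_ε)).mul (const (1 / Real.log 2))).mono fun p => le_of_eq ?_
    have h1 := p.one_le_n
    have h2 := p.ε_pos
    have h3 := c.acc_pos
    have h4 : 0 < c.K := by linarith [c.one_le_K]
    rw [← Real.log_mul (by positivity) (by positivity),
      ← Real.log_mul (by positivity) (by positivity), Real.logb]
    congr 1
    rw [mul_one_div]
    congr 2
    field_simp
  exact h.natCeil

theorem rates : PolyBounded fun p => ((c.size p.n p.samples p.ε).rates : ℝ) := by
  have h : PolyBounded fun p => Real.logb 2 p.n :=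
    (log_n.mul (const (1 / Real.log 2))).mono fun p => le_of_eq (by rw [Real.logb]; ring_nf)
  refine h.natCeil.mono fun p => le_of_eq ?_
  have := Real.natCeil_logb_natCast 2 p.n
  rw [Nat.cast_ofNat] at this
  rw [this]
  rfl

theorem reps : PolyBounded fun p => ((c.size p.n p.samples p.ε).reps : ℝ) := by
  have hr : PolyBounded fun p => (((c.size p.n p.samples p.ε).rates : ℝ) + 1) :=
    (rates c).add (const 1)
  have h : PolyBounded fun p => c.rep *
      Real.logb 2 (p.n * ((((Nat.clog 2 p.n : ℕ) : ℝ) + 1) * p.samples)) := by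
    refine (((log_n.add (hr.log fun p => by simp)).add log_samples).mul
      (const (c.rep / Real.log 2))).mono fun p => le_of_eq ?_
    have h1 := p.one_le_n
    have h2 : (0 : ℝ) < p.samples := by exact_mod_cast p.samples_pos
    change _ = |(Real.log p.n + Real.log (((Nat.clog 2 p.n : ℕ) : ℝ) + 1) + Real.log p.samples)
      * (c.rep / Real.log 2)|
    rw [Real.logb, Real.log_mul (by positivity) (by positivity),
      Real.log_mul (by positivity) (by positivity)]
    ring_nf
  refine (h.natCeil.add (const 1)).mono fun p => le_of_eq ?_
  simp [SketchConst.size]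

theorem top : PolyBounded fun p => ((c.size p.n p.samples p.ε).top : ℝ) := by
  refine ((((const (c.top / c.acc ^ 3)).mul ((levels c).pow 3)).mul (inv_ε.pow 3)).natCeil).mono
    fun p => le_of_eq ?_
  simp only [SketchConst.size]
  congr 3
  have := p.ε_pos
  have := c.acc_pos
  field_simp

/-- Rounding up to a power of two at most doubles; the `+ 1` covers `m = 0`. -/
theorem two_pow_clog_le (m : ℕ) : 2 ^ Nat.clog 2 m ≤ 2 * m + 1 := by
  rcases Nat.lt_or_ge 1 m with h | h
  · have h1 := Nat.pow_pred_clog_lt_self (b := 2) one_lt_two h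
    have h2 := Nat.clog_pos one_lt_two h
    obtain ⟨k, hk⟩ := Nat.exists_eq_succ_of_ne_zero h2.ne'
    rw [hk] at h1 ⊢
    rw [pow_succ]
    simp only [Nat.pred_succ, Nat.succ_eq_add_one] at h1
    omega
  · rw [Nat.clog_of_right_le_one h]
    omega

theorem two_pow_logBuckets {φ : SpaceParam → ℝ} (hφ : PolyBounded fun p => 1 / φ p) :
    PolyBounded fun p => (2 : ℝ) ^ logBuckets c (φ p) := by
  have h : PolyBounded fun p => c.width / (φ p ^ 2 * c.nu ^ 3) :=
    ((const (c.width / c.nu ^ 3)).mul (hφ.pow 2)).mono fun p => le_of_eq (by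
      congr 1
      rw [div_pow, one_pow, div_mul_div_comm, mul_one, mul_comm (c.nu ^ 3)])
  refine (((const 2).mul h.natCeil).add (const 1)).mono fun p => ?_
  refine abs_le_abs_of_nonneg (by positivity) ?_
  exact_mod_cast two_pow_clog_le _

/-- The crude `k ≤ 2 ^ k` bounds the width exponents in the word length. -/
theorem natCast_of_two_pow {k : SpaceParam → ℕ} (h : PolyBounded fun p => (2 : ℝ) ^ k p) :
    PolyBounded fun p => (k p : ℝ) :=
  h.mono fun p => abs_le_abs_of_nonneg (by positivity) (by
    exact_mod_cast Nat.lt_two_pow_self.le)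

theorem two_pow_logWidthZero :
    PolyBounded fun p => (2 : ℝ) ^ (c.size p.n p.samples p.ε).logWidthZero := by
  refine two_pow_logBuckets c (((const (c.K / (c.phi * c.acc ^ 3))).mul
    ((levels c).pow 3)).mul (inv_ε.pow 3) |>.mono fun p => le_of_eq ?_)
  simp only [SketchConst.size]
  congr 1
  rw [one_div_div, mul_pow]
  simp only [div_eq_mul_inv, mul_inv, one_mul, inv_pow]
  ring

theorem two_pow_logWidthSub :
    PolyBounded fun p => (2 : ℝ) ^ (c.size p.n p.samples p.ε).logWidthSub := by
  refine two_pow_logBuckets c (((const (1 / (c.phi * c.acc ^ 3))).mul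
    ((levels c).pow 3)).mul (inv_ε.pow 3) |>.mono fun p => le_of_eq ?_)
  simp only [SketchConst.size]
  congr 1
  rw [one_div_div, mul_pow]
  simp only [div_eq_mul_inv, mul_inv, one_mul, inv_pow]
  ring

theorem wordBits : PolyBounded fun p => ((c.size p.n p.samples p.ε).wordBits : ℝ) :=
  ((((rates c).add (natCast_of_two_pow (two_pow_logWidthZero c))).add
    (natCast_of_two_pow (two_pow_logWidthSub c))).add (const 1)).mono fun p => le_of_eq (by
      simp [SketchSize.wordBits])

end PolyBounded

/-- The space of one instance for each of the `d + 1` columns, and of the output. -/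
def spacePerColumn (P : SketchSize) : ℕ :=
  (P.rates + 1) * (P.reps * (2 ^ P.logWidthZero + 2 ^ P.logWidthSub)) + seedBits P
    + (P.rates + 1) * P.top * 2 + P.levels * 2 + 9

theorem card_tableCell_le (P : SketchSize) (d : ℕ) : Fintype.card (TableCell P d) ≤
    (P.rates + 1) * (P.reps * (2 ^ P.logWidthZero + 2 ^ P.logWidthSub)) * (d + 1) := by
  simp only [TableCell, Fintype.card_sigma, Fintype.card_prod, Fintype.card_fin]
  calc _ ≤ ∑ _ℓ : Fin (P.rates + 1),
        P.reps * (2 ^ P.logWidthZero + 2 ^ P.logWidthSub) * (d + 1) := by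
        refine Finset.sum_le_sum fun ℓ _ => ?_
        rw [← mul_assoc]
        refine Nat.mul_le_mul_right _ (Nat.mul_le_mul_left _ ?_)
        unfold SketchSize.width SketchSize.logWidth
        split_ifs
        · exact Nat.le_add_right _ _
        · exact Nat.le_add_left _ _
    _ = _ := by simp [mul_assoc]

theorem totalSpace_le (P : SketchSize) {d s : ℕ} (hs : 0 < s) :
    totalSpace P d s ≤ s * (d + 1) * spacePerColumn P := by
  have hc := card_tableCell_le P d
  have hI : instanceSpace P d + (d + 1) + d ≤ (d + 1) * spacePerColumn P := by
    unfold instanceSpace spacePerColumn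
    generalize (P.rates + 1) * (P.reps * (2 ^ P.logWidthZero + 2 ^ P.logWidthSub)) = a at *
    generalize seedBits P = b at *
    generalize (P.rates + 1) * P.top * 2 = e at *
    -- The terms not multiplied by a table size or level count add up to `3 d + 8 ≤ 9 (d + 1)`,
    -- whence the `9`.
    nlinarith [Nat.zero_le (d * b), Nat.zero_le (d * e), Nat.zero_le (d * P.levels)]
  calc totalSpace P d s ≤ s * (instanceSpace P d + (d + 1) + d) := by
        unfold totalSpace
        nlinarith [Nat.zero_le d]
    _ ≤ s * ((d + 1) * spacePerColumn P) := Nat.mul_le_mul_left _ hI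
    _ = _ := by ring

theorem PolyBounded.spacePerColumn (c : SketchConst) :
    PolyBounded fun p => (RegSketch.spacePerColumn (c.size p.n p.samples p.ε) : ℝ) := by
  have hr := (rates c).add (const 1)
  have hW := (two_pow_logWidthZero c).add (two_pow_logWidthSub c)
  have hseed := (((hr.mul (reps c)).mul (const 6)).add (hr.mul (const 2))).mul (wordBits c)
  refine ((((hr.mul ((reps c).mul hW)).add hseed).add ((hr.mul (top c)).mul (const 2))).add
    ((levels c).mul (const 2)) |>.add (const 9)).mono fun p => le_of_eq ?_
  simp [RegSketch.spacePerColumn, seedBits]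

theorem exists_totalSpace_bound (c : SketchConst) : ∃ B > (0 : ℝ), ∃ a : ℕ, ∀ p : SpaceParam,
    (totalSpace (c.size p.n p.samples p.ε) p.d p.samples : ℝ) ≤
      B * p.main * Real.log (2 + p.main) ^ a * (Real.log (2 + p.n) / p.ε) ^ a := by
  obtain ⟨B, hB, a, h⟩ := PolyBounded.spacePerColumn c
  refine ⟨66 * B, by positivity, 2 + a, fun p => ?_⟩
  have h1 := p.one_le_base
  have h2 := p.one_le_main
  have hT : (totalSpace (c.size p.n p.samples p.ε) p.d p.samples : ℝ) ≤
      p.samples * (p.d + 1) * spacePerColumn (c.size p.n p.samples p.ε) := by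
    exact_mod_cast totalSpace_le _ p.samples_pos
  rw [mul_assoc _ (Real.log (2 + p.main) ^ _), ← mul_pow]
  change _ ≤ 66 * B * p.main * p.base ^ (2 + a)
  calc _ ≤ _ := hT
    _ ≤ 66 * (p.main * p.base ^ 2) * (B * p.base ^ a) :=
        mul_le_mul p.samples_mul_le ((le_abs_self _).trans (h p)) (Nat.cast_nonneg _)
          (by positivity)
    _ = _ := by ring

end Space

end RegSketch

/-! ### Assembly -/

theorem mainTheorem6 :
    -- absolute constants: the quality `γ * ε` of the samples and the constant in `s`
    ∃ γ > (0 : ℝ), ∃ C > (0 : ℝ),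
    -- for any choice of the constants in the sizes of the sketch
    ∀ c : SketchConst, ∃ B > (0 : ℝ), ∃ a : ℕ,
    ∀ (n d : ℕ) (A : Matrix (Fin n) (Fin d) ℝ) (b : Fin n → ℝ) (ε δ : ℝ),
      0 < d → (logMatrix A).rank = d → 0 < ε → ε < 1 → 0 < δ → δ < 1 →
    ∀ s : ℕ,
      s = ⌈C * (d * condNumber (logMatrix A) ^ 2 / ε ^ 2) * Real.log (d / δ)⌉₊ →
      -- error bound for any good noisy row samples of `(f(A)  b)`
      (∀ (Ω : Type u) [MeasurableSpace Ω] (μ : Measure Ω) [IsProbabilityMeasure μ]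
          (h : Fin s → Ω → RowSample n d),
          GoodSampling μ (γ * ε) (augment (logMatrix A) b) h →
          μ {ω | ¬ RegressionGuarantee A b ε fun t => h t ω} ≤ ENNReal.ofReal δ) ∧
      -- the same for the one-pass streaming algorithm, whose samples come from the sketch;
      -- `μ` is any law of its randomness under which all samples are good, such as the
      -- uniform law conditioned on that event
      (∀ (S : List (Update n (d + 1))), streamMatrix S = augment A b →
        ∀ (Ω : Type u) [MeasurableSpace Ω] (μ : Measure Ω) [IsProbabilityMeasure μ]
          (ρ : Fin s → Ω → Randomness (c.size n s ε)) (Mhat : Fin s → Ω → ℝ)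
          (h : Fin s → Ω → RowSample n d),
          (∀ᵐ ω ∂μ, ∀ t,
            (ρ t ω).sample n (sketchStream (ρ t ω) S) (Mhat t ω) = some (h t ω)) →
          GoodSampling μ (γ * ε) (augment (logMatrix A) b) h →
          μ {ω | ¬ RegressionGuarantee A b ε fun t => h t ω} ≤ ENNReal.ofReal δ) ∧
      -- space `Õ(d² κ² log(1/δ)) * poly(log n, 1/ε)`
      (∀ X : ℝ, X = d ^ 2 * condNumber (logMatrix A) ^ 2 * max 1 (Real.log (1 / δ)) →
        (totalSpace (c.size n s ε) d s : ℝ) ≤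
          B * X * Real.log (2 + X) ^ a * (Real.log (2 + n) / ε) ^ a) := by
  refine ⟨1 / 4, by norm_num, 16, by norm_num, fun c => ?_⟩
  obtain ⟨B, hB, a, hspace⟩ := exists_totalSpace_bound c
  refine ⟨B, hB, a, fun n d A b ε δ hd hA hε hε1 hδ hδ1 s hs => ?_⟩
  have hκ := one_le_condNumber hd hA
  obtain ⟨hs0, hexp⟩ := exp_neg_le_of_sampleSize hd hκ hε hδ hδ1 hs
  have herr : ∀ (Ω : Type u) [MeasurableSpace Ω] (μ : Measure Ω) [IsProbabilityMeasure μ]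
      (h : Fin s → Ω → RowSample n d),
      GoodSampling μ (1 / 4 * ε) (augment (logMatrix A) b) h →
      μ {ω | ¬ RegressionGuarantee A b ε fun t => h t ω} ≤ ENNReal.ofReal δ :=
    fun Ω _ μ _ h H => (measure_not_regressionGuarantee_le hd hA hε hε1 hs0 H).trans
      (ENNReal.ofReal_le_ofReal hexp)
  refine ⟨herr, fun _ _ Ω _ μ _ _ _ h _ H => herr Ω μ h H, ?_⟩
  rintro X rfl
  -- Rank `d > 0` forces at least one row, which the logarithms of `n` need.
  have hn : 0 < n := hd.trans_le (hA ▸ (logMatrix A).rank_le_height)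
  subst hs
  exact hspace ⟨n, d, condNumber (logMatrix A), ε, δ, hn, hd, hκ, hε, hε1, hδ, hδ1⟩
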